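/- All manifolds and maps are smooth and all actions are from the left. Let $G$ be a Lie group with Lie algebra $\mathfrak g$, let $V$ be a finite-dimensional smooth representation of $G$, and let $(G,\omega,V)$ be a Pfaffian group, that is, a Pfaffian groupoid over the point, not necessarily full: $\omega\in\Omega^1(G,V)$ has constant rank and involutive kernel and is multiplicative, $\omega_{gh}(dm(v,w))=\omega_g(v)+g\cdot\omega_h(w)$ for $v\in T_gG$, $w\in T_hG$, where $m$ is the multiplication. Put $l:=\omega_e:\mathfrak g\to V$ and $\mathfrak h:=\ker l$, and write $(G,\mathfrak h,V)$ for this Pfaffian group. A principal $G$-bundle over a manifold $M$ is a manifold $P$ with a smooth free proper action $m_P:G\times P\to P$ and a $G$-invariant surjective submersion $\pi:P\to M$ on whose fibres $G$ acts transitively. For $\alpha\in\mathfrak g$ let $\alpha^\dagger_p:=d(g\mapsto g\cdot p)_e(\alpha)\in T_pP$. A subspace of $T_pP$ is called vertical if it lies in $\ker(d\pi)_p$; a foliation is identified with its tangent distribution (an involutive subbundle of $TP$), and its normal bundle is $\nu_{\mathcal F}=TP/T\mathcal F$. A full principal Pfaffian $(G,\mathfrak h,V)$-bundle (Cartan bundle)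 over $M$ is a principal $G$-bundle $P$ over $M$ with a pointwise surjective form $\theta\in\Omega^1(P,V)$ such that $$\theta_{g\cdot p}(dm_P(v,w))=\omega_g(v)+g\cdot\theta_p(w)\qquad (v\in T_gG,\ w\in T_pP)$$ and $\ker(d\mu)\cap\ker\theta=\ker(d\pi)\cap\ker\theta$, where $\mu:P\to\{\ast\}$ is the moment map (so $\ker\theta\subset\ker d\pi$). Then the following hold. (1) A full principal Pfaffian $(G,\mathfrak h,V)$-bundle over $M$ is equivalent to the datum of a principal $G$-bundle $P$ over $M$ together with a $G$-equivariant vertical foliation $\mathcal F$ on $P$ and an isomorphism of $G$-equivariant vector bundles $\Phi:\nu_{\mathcal F}\to P\times V$ over $P$ with $\Phi([\alpha^\dagger_p])=(p,l(\alpha))$ for all $\alpha\in\mathfrak g$, $p\in P$. Precisely: on every principal $G$-bundle $P$ over $M$, the rules $T\mathcal F=\ker\theta$ and $\Phi([v])=(p,\theta_p(v))$ for $v\in T_pP$ define a bijection between the forms $\theta$ as above and the pairs $(\mathcal F,\Phi)$; and a morphism $\Psi$ of principal $G$-bundles over $M$ satisfies $\Psi^*\theta'=\theta$ if and only if $d\Psi(T\mathcal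 F)\subset T\mathcal F'$ and $\Psi$ intertwines $\Phi$ and $\Phi'$. (2) Alternatively, a full principal Pfaffian $(G,\mathfrak h,V)$-bundle over $M$ is equivalent to the datum of a principal $G$-bundle $P$ over $M$ together with a pointwise surjective $G$-equivariant form $\theta\in\Omega^1(P,V)$ whose kernel is involutive and vertical and which satisfies $\theta(\alpha^\dagger_p)=l(\alpha)$ for all $\alpha\in\mathfrak g$, $p\in P$; the equivalence keeps $P$, $\theta$ and the form-preserving morphisms of principal $G$-bundles. -/

import Mathlib

open scoped Manifold ContDiff

noncomputable section

namespace Pfaffian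

universe u v

section General

variable {E : Type*} [NormedAddCommGroup E] [NormedSpace ℝ E]
  {X : Type*} [TopologicalSpace X] [ChartedSpace E X]
  {V : Type*} [NormedAddCommGroup V] [NormedSpace ℝ V]

/-- A `V`-valued one-form on `X` is smooth if it is smooth as a map `TX → V`. -/
def IsSmoothForm [IsManifold 𝓘(ℝ, E) ∞ X]
    (θ : ∀ x : X, TangentSpace 𝓘(ℝ, E) x →L[ℝ] V) : Prop :=
  ContMDiff 𝓘(ℝ, E).tangent 𝓘(ℝ, V) ∞
    (fun w : TangentBundle 𝓘(ℝ, E) X => (θ w.proj w.snd : V))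

/-- The vector field `Y` is smooth on the set `U`. -/
def IsSmoothFieldOn [IsManifold 𝓘(ℝ, E) ∞ X]
    (Y : ∀ x : X, TangentSpace 𝓘(ℝ, E) x) (U : Set X) : Prop :=
  ContMDiffOn 𝓘(ℝ, E) 𝓘(ℝ, E).tangent ∞
    (fun x => (⟨x, Y x⟩ : TangentBundle 𝓘(ℝ, E) X)) U

/-- A family of tangent subspaces is a (regular, smooth) distribution, that is, a vector subbundle
of the tangent bundle: it has local frames of constant length. -/
def IsRegularDistribution [IsManifold 𝓘(ℝ, E) ∞ X]
    (D : ∀ x : X, Submodule ℝ (TangentSpace 𝓘(ℝ, E) x)) : Prop :=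
  ∃ k : ℕ, ∀ x : X, ∃ U : Set X, IsOpen U ∧ x ∈ U ∧
    ∃ Y : Fin k → ∀ y : X, TangentSpace 𝓘(ℝ, E) y,
      (∀ i, IsSmoothFieldOn (Y i) U) ∧
      ∀ y ∈ U, LinearIndependent ℝ (fun i => Y i y) ∧
        Submodule.span ℝ (Set.range fun i => Y i y) = D y

/-- Involutivity: the bracket of two (locally defined) smooth vector fields tangent to `D` is
tangent to `D`. -/
def IsInvolutive [IsManifold 𝓘(ℝ, E) ∞ X]
    (D : ∀ x : X, Submodule ℝ (TangentSpace 𝓘(ℝ, E) x)) : Prop :=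
  ∀ (U : Set X), IsOpen U → ∀ Y Z : ∀ x : X, TangentSpace 𝓘(ℝ, E) x,
    IsSmoothFieldOn Y U → IsSmoothFieldOn Z U →
    (∀ x ∈ U, Y x ∈ D x) → (∀ x ∈ U, Z x ∈ D x) →
    ∀ x ∈ U, VectorField.mlieBracket 𝓘(ℝ, E) Y Z x ∈ D x

variable (E X) in
/-- A foliation, given by its tangent distribution: an involutive subbundle of the tangent
bundle. -/
structure Foliation [IsManifold 𝓘(ℝ, E) ∞ X] where
  /-- The tangent space to the leaf through each point. -/
  tangent : ∀ x : X, Submodule ℝ (TangentSpace 𝓘(ℝ, E) x)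
  regular : IsRegularDistribution tangent
  involutive : IsInvolutive tangent

/-- The kernel of the differential at `x` of the map from `X` to the one-point manifold. For a
group, seen as a groupoid over the point, this map is both the source and the target; for a
principal bundle of a group it is the moment map. -/
def kerToPoint (x : X) : Submodule ℝ (TangentSpace 𝓘(ℝ, E) x) :=
  (mfderiv 𝓘(ℝ, E) 𝓘(ℝ, PUnit.{1}) (fun _ : X => PUnit.unit) x).ker

end General

section Group

variable (EG : Type*) [NormedAddCommGroup EG] [NormedSpace ℝ EG]
  (G : Type*) [Group G] [TopologicalSpace G] [ChartedSpace EG G] [LieGroup 𝓘(ℝ, EG) ∞ G]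
  (V : Type*) [NormedAddCommGroup V] [NormedSpace ℝ V]

/-- A Pfaffian group `(G, ω, V)`: a Pfaffian groupoid over the point with arrow space the Lie group
`G`. The condition that `ker ω` meets the kernels of the differentials of the source and of the
target in the same subbundle is void, since source and target coincide. The Pfaffian group is not
required to be full, i.e. `ω` need not be surjective. -/
structure PfaffianGroup where
  /-- The representation of `G` on `V`. -/
  ρ : Representation ℝ G V
  smooth_ρ : ContMDiff (𝓘(ℝ, EG).prod 𝓘(ℝ, V)) 𝓘(ℝ, V) ∞ (fun x : G × V => ρ x.1 x.2)
  /-- The Pfaffian form `ω`. -/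
  form : ∀ g : G, TangentSpace 𝓘(ℝ, EG) g →L[ℝ] V
  smooth_form : IsSmoothForm form
  multiplicative : ∀ (g h : G) (v : TangentSpace 𝓘(ℝ, EG) g) (w : TangentSpace 𝓘(ℝ, EG) h),
    form (g * h) (mfderiv (𝓘(ℝ, EG).prod 𝓘(ℝ, EG)) 𝓘(ℝ, EG) (fun x : G × G => x.1 * x.2) (g, h)
      ((v, w) : EG × EG)) = form g v + ρ g (form h w)
  constant_rank : ∃ r : ℕ, ∀ g, Module.finrank ℝ (form g).range = r
  source_transversal : ∀ g, (form g).ker ⊔ kerToPoint g = ⊤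
  symbol_involutive : IsInvolutive fun g => (form g).ker ⊓ kerToPoint g

end Group

section Bundle

variable (EG : Type*) [NormedAddCommGroup EG] [NormedSpace ℝ EG]
  (G : Type*) [Group G] [TopologicalSpace G] [ChartedSpace EG G]
  (EM : Type*) [NormedAddCommGroup EM] [NormedSpace ℝ EM]
  (M : Type*) [TopologicalSpace M] [ChartedSpace EM M]

/-- A (left) principal `G`-bundle over `M`: a Hausdorff finite-dimensional manifold with a smooth,
free and proper action of `G`, and an invariant surjective submersion to `M` on whose fibres the
action is transitive. -/
structure PrincipalBundle where
  /-- The model vector space of the total space. -/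
  E : Type u
  [normedE : NormedAddCommGroup E]
  [normedSpaceE : NormedSpace ℝ E]
  [finiteE : FiniteDimensional ℝ E]
  /-- The total space. -/
  carrier : Type v
  [topology : TopologicalSpace carrier]
  [charted : ChartedSpace E carrier]
  [manifold : IsManifold 𝓘(ℝ, E) ∞ carrier]
  [hausdorff : T2Space carrier]
  [action : MulAction G carrier]
  [smooth_action : ContMDiffSMul 𝓘(ℝ, EG) 𝓘(ℝ, E) ∞ G carrier]
  [proper : ProperSMul G carrier]
  free : ∀ (g : G) (p : carrier), g • p = p → g = 1
  /-- The projection to the base. -/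
  π : carrier → M
  surjective_π : Function.Surjective π
  submersion_π : Manifold.IsSubmersion 𝓘(ℝ, E) 𝓘(ℝ, EM) ∞ π
  invariant_π : ∀ (g : G) (p : carrier), π (g • p) = π p
  transitive : ∀ p q : carrier, π p = π q → ∃ g : G, q = g • p

attribute [instance] PrincipalBundle.normedE PrincipalBundle.normedSpaceE PrincipalBundle.finiteE
  PrincipalBundle.topology PrincipalBundle.charted PrincipalBundle.manifold
  PrincipalBundle.hausdorff PrincipalBundle.action PrincipalBundle.smooth_action
  PrincipalBundle.proper

instance : CoeSort (PrincipalBundle.{u, v} EG G EM M) (Type v) := ⟨PrincipalBundle.carrier⟩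

end Bundle

namespace PrincipalBundle

variable {EG : Type*} [NormedAddCommGroup EG] [NormedSpace ℝ EG]
  {G : Type*} [Group G] [TopologicalSpace G] [ChartedSpace EG G]
  {EM : Type*} [NormedAddCommGroup EM] [NormedSpace ℝ EM]
  {M : Type*} [TopologicalSpace M] [ChartedSpace EM M]

/-- The tangent space of the total space. -/
abbrev T (P : PrincipalBundle.{u, v} EG G EM M) (p : P) : Type u := TangentSpace 𝓘(ℝ, P.E) p

/-- The vertical space at `p`. -/
def vertical (P : PrincipalBundle.{u, v} EG G EM M) (p : P) : Submodule ℝ (P.T p) :=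
  (mfderiv 𝓘(ℝ, P.E) 𝓘(ℝ, EM) P.π p).ker

/-- The differential at `p` of the action of `g`. -/
def dAct (P : PrincipalBundle.{u, v} EG G EM M) (g : G) (p : P) : P.T p →L[ℝ] P.T (g • p) :=
  mfderiv 𝓘(ℝ, P.E) 𝓘(ℝ, P.E) (fun q : P => g • q) p

/-- The value at `p` of the fundamental vector field `α†` of `α ∈ 𝔤 = T₁G`: the image of `α` under
the differential at `1` of `g ↦ g • p`. (The latter lies in the tangent space at `1 • p = p`.) -/
def fundamental (P : PrincipalBundle.{u, v} EG G EM M) (α : GroupLieAlgebra 𝓘(ℝ, EG) G) (p : P) :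
    P.T p :=
  (mfderiv 𝓘(ℝ, EG) 𝓘(ℝ, P.E) (fun g : G => g • p) 1 α : P.E)

/-- A morphism of principal `G`-bundles over `M`. -/
structure Hom (P Q : PrincipalBundle.{u, v} EG G EM M) where
  /-- The underlying map. -/
  map : P → Q
  smooth : ContMDiff 𝓘(ℝ, P.E) 𝓘(ℝ, Q.E) ∞ map
  equivariant : ∀ (g : G) (p : P), map (g • p) = g • map p
  over_base : ∀ p : P, Q.π (map p) = P.π p

/-- The differential of a morphism of principal bundles. -/
def Hom.d {P Q : PrincipalBundle.{u, v} EG G EM M} (Ψ : Hom P Q) (p : P) :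
    P.T p →L[ℝ] Q.T (Ψ.map p) :=
  mfderiv 𝓘(ℝ, P.E) 𝓘(ℝ, Q.E) Ψ.map p

end PrincipalBundle

section Cartan

variable {EG : Type*} [NormedAddCommGroup EG] [NormedSpace ℝ EG]
  {G : Type*} [Group G] [TopologicalSpace G] [ChartedSpace EG G] [LieGroup 𝓘(ℝ, EG) ∞ G]
  {V : Type*} [NormedAddCommGroup V] [NormedSpace ℝ V]
  {EM : Type*} [NormedAddCommGroup EM] [NormedSpace ℝ EM]
  {M : Type*} [TopologicalSpace M] [ChartedSpace EM M]

/-- The map `l = ω_e : 𝔤 → V` of a Pfaffian group; its kernel is the subspace `𝔥` in the notation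
`(G, 𝔥, V)`. -/
def PfaffianGroup.l (A : PfaffianGroup EG G V) : GroupLieAlgebra 𝓘(ℝ, EG) G →L[ℝ] V := A.form 1

/-- The form `θ` on `P` is `G`-equivariant. -/
def IsEquivariantForm (A : PfaffianGroup EG G V) (P : PrincipalBundle.{u, v} EG G EM M)
    (θ : ∀ p : P, P.T p →L[ℝ] V) : Prop :=
  ∀ (g : G) (p : P) (w : P.T p), θ (g • p) (P.dAct g p w) = A.ρ g (θ p w)

/-- A full principal Pfaffian `(G, 𝔥, V)`-bundle structure on the principal `G`-bundle `P`. -/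
@[ext] structure FullPfaffian (A : PfaffianGroup EG G V)
    (P : PrincipalBundle.{u, v} EG G EM M) where
  θ : ∀ p : P, P.T p →L[ℝ] V
  smooth : IsSmoothForm θ
  multiplicative : ∀ (g : G) (p : P) (v : TangentSpace 𝓘(ℝ, EG) g) (w : P.T p),
    θ (g • p) (mfderiv (𝓘(ℝ, EG).prod 𝓘(ℝ, P.E)) 𝓘(ℝ, P.E) (fun x : G × P => x.1 • x.2) (g, p)
      ((v, w) : EG × P.E)) = A.form g v + A.ρ g (θ p w)
  moment_projection : ∀ p : P, kerToPoint p ⊓ (θ p).ker = P.vertical p ⊓ (θ p).ker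
  full : ∀ p : P, Function.Surjective (θ p)

/-- A `G`-equivariant vertical foliation `F` on `P` with an isomorphism `Φ` of `G`-equivariant
vector bundles over `P` from the normal bundle `TP / F` to `P × V`, such that
`Φ [α†_p] = (p, l α)`. The isomorphism is given fibrewise. As the normal bundle is the quotient of
`TP` by `F`, a bundle map out of it is smooth when its composition with the projection of `TP` is
smooth. -/
@[ext] structure FoliationData (A : PfaffianGroup EG G V)
    (P : PrincipalBundle.{u, v} EG G EM M) where
  F : Foliation P.E P
  F_equivariant : ∀ (g : G) (p : P),
    (F.tangent p).map (P.dAct g p : P.T p →ₗ[ℝ] P.T (g • p)) = F.tangent (g • p)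
  F_vertical : ∀ p : P, F.tangent p ≤ P.vertical p
  Φ : ∀ p : P, (P.T p ⧸ F.tangent p) ≃ₗ[ℝ] V
  Φ_smooth : ContMDiff 𝓘(ℝ, P.E).tangent 𝓘(ℝ, V) ∞
    (fun w : TangentBundle 𝓘(ℝ, P.E) P => Φ w.proj ((F.tangent w.proj).mkQ w.snd))
  Φ_equivariant : ∀ (g : G) (p : P) (w : P.T p),
    Φ (g • p) ((F.tangent (g • p)).mkQ (P.dAct g p w)) = A.ρ g (Φ p ((F.tangent p).mkQ w))
  Φ_fundamental : ∀ (α : GroupLieAlgebra 𝓘(ℝ, EG) G) (p : P),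
    Φ p ((F.tangent p).mkQ (P.fundamental α p)) = A.l α

/-- A (smooth, pointwise surjective) equivariant `V`-valued one-form on `P` with involutive and
vertical kernel, such that `θ(α†_p) = l α`. -/
@[ext] structure FormData (A : PfaffianGroup EG G V)
    (P : PrincipalBundle.{u, v} EG G EM M) where
  θ : ∀ p : P, P.T p →L[ℝ] V
  smooth : IsSmoothForm θ
  surjective : ∀ p : P, Function.Surjective (θ p)
  equivariant : IsEquivariantForm A P θ
  ker_involutive : IsInvolutive fun p : P => (θ p).ker
  ker_vertical : ∀ p : P, (θ p).ker ≤ P.vertical p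
  fundamental : ∀ (α : GroupLieAlgebra 𝓘(ℝ, EG) G) (p : P), θ p (P.fundamental α p) = A.l α

variable {A : PfaffianGroup EG G V} {P Q : PrincipalBundle.{u, v} EG G EM M}

/-- `Ψ` is a morphism of principal Pfaffian bundles: `Ψ^* θ' = θ`. -/
def FullPfaffian.IsMorphism (S : FullPfaffian A P) (S' : FullPfaffian A Q)
    (Ψ : PrincipalBundle.Hom P Q) : Prop :=
  ∀ (p : P) (w : P.T p), S'.θ (Ψ.map p) (Ψ.d p w) = S.θ p w

/-- `Ψ` maps leaves into leaves, and the induced map of normal bundles is compatible with the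
isomorphisms to the trivial bundles. -/
def FoliationData.IsMorphism (S : FoliationData A P) (S' : FoliationData A Q)
    (Ψ : PrincipalBundle.Hom P Q) : Prop :=
  (∀ p : P, (S.F.tangent p).map (Ψ.d p : P.T p →ₗ[ℝ] Q.T (Ψ.map p)) ≤ S'.F.tangent (Ψ.map p)) ∧
  ∀ (p : P) (w : P.T p), S'.Φ (Ψ.map p) ((S'.F.tangent (Ψ.map p)).mkQ (Ψ.d p w)) =
    S.Φ p ((S.F.tangent p).mkQ w)

/-- `Ψ` preserves the forms. -/
def FormData.IsMorphism (S : FormData A P) (S' : FormData A Q)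
    (Ψ : PrincipalBundle.Hom P Q) : Prop :=
  ∀ (p : P) (w : P.T p), S'.θ (Ψ.map p) (Ψ.d p w) = S.θ p w

end Cartan

end Pfaffian

end

open Pfaffian

open scoped Topology
open Set Filter

noncomputable section

namespace Pfaffian

universe u v

/-! ### One-forms in charts: Cartan's formula and pullback of the exterior derivative. -/

section LocalForm

variable {E : Type*} [NormedAddCommGroup E] [NormedSpace ℝ E]
  {X : Type*} [TopologicalSpace X] [ChartedSpace E X]
  {E' : Type*} [NormedAddCommGroup E'] [NormedSpace ℝ E']
  {X' : Type*} [TopologicalSpace X'] [ChartedSpace E' X']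
  {V : Type*} [NormedAddCommGroup V] [NormedSpace ℝ V]

/-! The differential of the action at `(g, p)` sends `(v, w)` to the orbit derivative of `v` plus
the translate of `w` (`mfderiv_smul_apply`). Multiplicativity of `θ` therefore says two things: `θ`
is equivariant, and its pullback to each orbit is `ω`. Left translation carries the second condition
at `g` back to `g = 1` (`dOrbit_mulInvariantVectorField`, `form_mulInvariantVectorField`), where it
reads `θ(α†) = l α`. The moment map is constant, so the remaining kernel condition says exactly that
`ker θ` is vertical.

What is left is that `ker θ` is involutive for every full Pfaffian bundle. By Cartan's formula,
`θ([Y, Z]) = -dθ(Y, Z)` for `Y`, `Z` in `ker θ`, and the right side depends only on the values at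
the point. These values are vertical, hence of the form `α†`, `β†` with `α, β ∈ 𝔥`. Pulling back to
the orbit gives `dω(α, β)`, which vanishes: the left invariant extensions of `α`, `β` lie in the
involutive distribution `ker ω` (`extD_form_eq_zero`, `extD_pullback`).

That vertical vectors are fundamental (`exists_fundamental_eq_of_mem_vertical`) is a dimension
count. The orbit map is an immersion because the action is free, by uniqueness of integral curves.
The fibre has at most the dimension of `G`, since by properness it is near `p` the smooth image of a
ball in a chart of `G`, and such maps do not raise Hausdorff dimension.

Finally, `θ` and `(F, Φ)` determine each other by the first isomorphism theorem. The kernel is a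
subbundle because a surjective family has local frames of kernels (`isRegularDistribution_ker`). -/

/-- The differential of the inverse of the preferred chart at `x`. -/
def chartSymmDeriv (x : X) (z : E) :
    E →L[ℝ] TangentSpace 𝓘(ℝ, E) ((extChartAt 𝓘(ℝ, E) x).symm z) :=
  mfderiv 𝓘(ℝ, E) 𝓘(ℝ, E) (extChartAt 𝓘(ℝ, E) x).symm z

/-- The one-form `θ` read in the preferred chart at `x`. -/
def localForm (θ : ∀ x : X, TangentSpace 𝓘(ℝ, E) x →L[ℝ] V) (x : X) (z : E) : E →L[ℝ] V :=
  (θ ((extChartAt 𝓘(ℝ, E) x).symm z)).comp (chartSymmDeriv x z)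

/-- The exterior derivative of the one-form `θ` at `x`. -/
def extD (θ : ∀ x : X, TangentSpace 𝓘(ℝ, E) x →L[ℝ] V) (x : X)
    (a b : TangentSpace 𝓘(ℝ, E) x) : V :=
  fderiv ℝ (localForm θ x) (extChartAt 𝓘(ℝ, E) x x) a b
    - fderiv ℝ (localForm θ x) (extChartAt 𝓘(ℝ, E) x x) b a

/-- A vector field read in the preferred chart at `x`. -/
def localField (Y : ∀ x : X, TangentSpace 𝓘(ℝ, E) x) (x : X) (z : E) : E :=
  (chartSymmDeriv x z).inverse (Y ((extChartAt 𝓘(ℝ, E) x).symm z))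

lemma mpullbackWithin_extChartAt_symm (Y : ∀ x : X, TangentSpace 𝓘(ℝ, E) x) (x : X) :
    VectorField.mpullbackWithin 𝓘(ℝ, E) 𝓘(ℝ, E) (extChartAt 𝓘(ℝ, E) x).symm Y
      (range 𝓘(ℝ, E)) = localField Y x := by
  funext z
  rw [VectorField.mpullbackWithin_apply, modelWithCornersSelf_coe, range_id, mfderivWithin_univ]
  rfl

variable [IsManifold 𝓘(ℝ, E) ∞ X] [IsManifold 𝓘(ℝ, E') ∞ X']

lemma mdifferentiableAt_extChartAt_symm {x : X} {z : E}
    (hz : z ∈ (extChartAt 𝓘(ℝ, E) x).target) :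
    MDifferentiableAt 𝓘(ℝ, E) 𝓘(ℝ, E) (extChartAt 𝓘(ℝ, E) x).symm z :=
  ((contMDiffOn_extChartAt_symm (I := 𝓘(ℝ, E)) (n := ∞) x).contMDiffAt
    ((isOpen_extChartAt_target x).mem_nhds hz)).mdifferentiableAt (by simp)

lemma chartSymmDeriv_self (x : X) :
    chartSymmDeriv x (extChartAt 𝓘(ℝ, E) x x) = ContinuousLinearMap.id ℝ E := by
  have : IsManifold 𝓘(ℝ, E) 1 X := IsManifold.of_le (n := ∞) (by simp)
  have h := mfderivWithin_range_extChartAt_symm (I := 𝓘(ℝ, E)) (x := x)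
  rw [modelWithCornersSelf_coe, range_id, mfderivWithin_univ] at h
  exact h

lemma chartSymmDeriv_isInvertible {x : X} {z : E} (hz : z ∈ (extChartAt 𝓘(ℝ, E) x).target) :
    (chartSymmDeriv x z).IsInvertible := by
  have : IsManifold 𝓘(ℝ, E) 1 X := IsManifold.of_le (n := ∞) (by simp)
  have h := isInvertible_mfderivWithin_extChartAt_symm (I := 𝓘(ℝ, E)) hz
  rw [modelWithCornersSelf_coe, range_id, mfderivWithin_univ] at h
  exact h

lemma localForm_self (θ : ∀ x : X, TangentSpace 𝓘(ℝ, E) x →L[ℝ] V) (x : X) (a : E) :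
    localForm θ x (extChartAt 𝓘(ℝ, E) x x) a = θ x a := by
  -- The inverse chart returns to `x` only up to a propositional equality. All tangent spaces are
  -- copies of `E`, so values are transported by substituting the point; the later `key` facts do
  -- the same.
  have key : ∀ (y : X) (a : E), y = x → θ y a = θ x a := by
    rintro y a rfl; rfl
  have h1 : (chartSymmDeriv x (extChartAt 𝓘(ℝ, E) x x) a : E) = a :=
    DFunLike.congr_fun (chartSymmDeriv_self x) a
  have h2 := key _ (chartSymmDeriv x (extChartAt 𝓘(ℝ, E) x x) a) (extChartAt_to_inv (I := 𝓘(ℝ, E)) x)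
  exact h2.trans (congrArg (fun e : E => (θ x : E →L[ℝ] V) e) h1)

/-- In finite dimension, smoothness of an operator-valued map can be tested on a fixed vector `e`.
There the local form is `θ` composed with the tangent map of the inverse chart along the constant
field `e`. -/
lemma contDiffOn_localForm [FiniteDimensional ℝ E]
    {θ : ∀ x : X, TangentSpace 𝓘(ℝ, E) x →L[ℝ] V} (hθ : IsSmoothForm θ) (x : X) :
    ContDiffOn ℝ ∞ (localForm θ x) (extChartAt 𝓘(ℝ, E) x).target := by
  rw [contDiffOn_clm_apply]
  intro e
  rw [← contMDiffOn_iff_contDiffOn]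
  have hs := (isOpen_extChartAt_target (I := 𝓘(ℝ, E)) x).uniqueMDiffOn (I := 𝓘(ℝ, E))
  have h1 := (contMDiffOn_extChartAt_symm (I := 𝓘(ℝ, E)) (n := ∞) x).contMDiffOn_tangentMapWithin
    (m := ∞) (by simp) hs
  have h2 : ContMDiff 𝓘(ℝ, E) 𝓘(ℝ, E).tangent ∞
      (fun z : E => (⟨z, e⟩ : TangentBundle 𝓘(ℝ, E) E)) :=
    contMDiff_vectorSpace_iff_contDiff.2 contDiff_const
  have h3 := hθ.comp_contMDiffOn (h1.comp (h2.contMDiffOn (s := (extChartAt 𝓘(ℝ, E) x).target))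
    (fun z hz => hz))
  refine h3.congr fun z hz => ?_
  simp only [Function.comp_apply, tangentMapWithin]
  rw [mfderivWithin_eq_mfderiv (hs z hz) (mdifferentiableAt_extChartAt_symm hz)]
  rfl

lemma localForm_localField (θ : ∀ x : X, TangentSpace 𝓘(ℝ, E) x →L[ℝ] V)
    (Y : ∀ x : X, TangentSpace 𝓘(ℝ, E) x) {x : X} {z : E}
    (hz : z ∈ (extChartAt 𝓘(ℝ, E) x).target) :
    localForm θ x z (localField Y x z) =
      θ ((extChartAt 𝓘(ℝ, E) x).symm z) (Y ((extChartAt 𝓘(ℝ, E) x).symm z)) := by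
  have h := (chartSymmDeriv_isInvertible hz).self_apply_inverse
    (Y ((extChartAt 𝓘(ℝ, E) x).symm z))
  exact congrArg (θ ((extChartAt 𝓘(ℝ, E) x).symm z)) h

lemma localField_self (Y : ∀ x : X, TangentSpace 𝓘(ℝ, E) x) (x : X) :
    localField Y x (extChartAt 𝓘(ℝ, E) x x) = Y x := by
  have key : ∀ (y : X), y = x → (Y y : E) = Y x := by
    rintro y rfl; rfl
  have h1 : ((chartSymmDeriv x (extChartAt 𝓘(ℝ, E) x x)) : E →L[ℝ] E).inverse =
      ContinuousLinearMap.id ℝ E := by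
    have := chartSymmDeriv_self (E := E) x
    exact (congrArg (fun f : E →L[ℝ] E => f.inverse) this).trans ContinuousLinearMap.inverse_id
  exact (DFunLike.congr_fun h1 _).trans (key _ (extChartAt_to_inv (I := 𝓘(ℝ, E)) x))

/-- The Lie bracket of two vector fields is computed in the preferred chart. -/
lemma mlieBracket_eq_lieBracket_localField (Y Z : ∀ x : X, TangentSpace 𝓘(ℝ, E) x) (x : X) :
    VectorField.mlieBracket 𝓘(ℝ, E) Y Z x =
      VectorField.lieBracket ℝ (localField Y x) (localField Z x) (extChartAt 𝓘(ℝ, E) x x) := by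
  have : IsManifold 𝓘(ℝ, E) 1 X := IsManifold.of_le (n := ∞) (by simp)
  rw [← VectorField.mlieBracketWithin_univ, VectorField.mlieBracketWithin_apply,
    mpullbackWithin_extChartAt_symm, mpullbackWithin_extChartAt_symm, mfderiv_extChartAt_self,
    preimage_univ, univ_inter, modelWithCornersSelf_coe, range_id,
    VectorField.lieBracketWithin_univ]
  exact DFunLike.congr_fun (ContinuousLinearMap.inverse_id (R := ℝ) (M := E)) _

lemma differentiableAt_localField [CompleteSpace E] {Y : ∀ x : X, TangentSpace 𝓘(ℝ, E) x}
    {U : Set X} {x : X} (hU : U ∈ 𝓝 x) (hY : IsSmoothFieldOn Y U) :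
    DifferentiableAt ℝ (localField Y x) (extChartAt 𝓘(ℝ, E) x x) := by
  have h : ContMDiffWithinAt 𝓘(ℝ, E) 𝓘(ℝ, E).tangent ∞
    (fun x => (⟨x, Y x⟩ : TangentBundle 𝓘(ℝ, E) X)) univ x :=
    (hY.contMDiffAt hU)
  have h2 := VectorField.contMDiffWithinAt_mpullbackWithin_extChartAt_symm (n := ∞) (m := ∞)
    h uniqueMDiffOn_univ (mem_univ x) (by simp)
  rw [contMDiffWithinAt_vectorSpace_iff_contDiffWithinAt, preimage_univ, inter_univ] at h2
  have h3 := (h2.contDiffAt (extChartAt_target_mem_nhds x)).differentiableAt (by simp)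
  exact mpullbackWithin_extChartAt_symm Y x ▸ h3

lemma differentiableAt_localForm [FiniteDimensional ℝ E]
    {θ : ∀ x : X, TangentSpace 𝓘(ℝ, E) x →L[ℝ] V} (hθ : IsSmoothForm θ) (x : X) :
    DifferentiableAt ℝ (localForm θ x) (extChartAt 𝓘(ℝ, E) x x) :=
  ((contDiffOn_localForm hθ x).contDiffAt (extChartAt_target_mem_nhds x)).differentiableAt (by simp)

/-- Cartan's formula for two vector fields in the kernel of a one-form. -/
lemma apply_mlieBracket_eq_neg_extD [FiniteDimensional ℝ E]
    {θ : ∀ x : X, TangentSpace 𝓘(ℝ, E) x →L[ℝ] V} (hθ : IsSmoothForm θ)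
    {Y Z : ∀ x : X, TangentSpace 𝓘(ℝ, E) x} {U : Set X} {x : X} (hU : U ∈ 𝓝 x)
    (hY : IsSmoothFieldOn Y U) (hZ : IsSmoothFieldOn Z U)
    (hθY : ∀ y ∈ U, θ y (Y y) = 0) (hθZ : ∀ y ∈ U, θ y (Z y) = 0) :
    θ x (VectorField.mlieBracket 𝓘(ℝ, E) Y Z x) = - extD θ x (Y x) (Z x) := by
  have : CompleteSpace E := FiniteDimensional.complete ℝ E
  set z := extChartAt 𝓘(ℝ, E) x x with hz
  have hcont : Tendsto (extChartAt 𝓘(ℝ, E) x).symm (𝓝 z) (𝓝 x) := by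
    have h := continuousAt_extChartAt_symm (I := 𝓘(ℝ, E)) x
    rwa [ContinuousAt, extChartAt_to_inv] at h
  have key : ∀ {Y : ∀ x : X, TangentSpace 𝓘(ℝ, E) x}, IsSmoothFieldOn Y U →
      (∀ y ∈ U, θ y (Y y) = 0) → ∀ a : E,
      fderiv ℝ (localForm θ x) z a (localField Y x z) =
        - localForm θ x z (fderiv ℝ (localField Y x) z a) := by
    intro Y hY hθY a
    -- The function `θ(Y)` vanishes near `x`; the product rule then trades the derivative of `θ` for
    -- that of `Y`.
    have h1 : (fun w => localForm θ x w (localField Y x w)) =ᶠ[𝓝 z] fun _ => 0 := by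
      filter_upwards [hcont hU, extChartAt_target_mem_nhds (I := 𝓘(ℝ, E)) x] with w hw hw'
      rw [localForm_localField θ Y hw']
      exact hθY _ hw
    have h2 := ((differentiableAt_localForm hθ x).hasFDerivAt.clm_apply
      (differentiableAt_localField hU hY).hasFDerivAt).fderiv
    rw [h1.fderiv_eq, fderiv_fun_const] at h2
    have h3 := DFunLike.congr_fun h2 a
    simp only [Pi.zero_apply, zero_apply, add_apply,
      ContinuousLinearMap.comp_apply, ContinuousLinearMap.flip_apply] at h3
    rw [eq_neg_iff_add_eq_zero, add_comm]
    exact h3.symm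
  have h1 := key hY hθY (localField Z x z)
  have h2 := key hZ hθZ (localField Y x z)
  refine (localForm_self θ x _).symm.trans ?_
  have h3 : extD θ x (Y x) (Z x) = fderiv ℝ (localForm θ x) z (localField Y x z)
      (localField Z x z) - fderiv ℝ (localForm θ x) z (localField Z x z) (localField Y x z) := by
    rw [localField_self, localField_self]; rfl
  rw [mlieBracket_eq_lieBracket_localField, VectorField.lieBracket_eq, h3, h1, h2, map_sub]
  abel

/-- The exterior derivative commutes with pullback. -/
lemma extD_pullback [FiniteDimensional ℝ E] [FiniteDimensional ℝ E']
    {θ : ∀ x : X, TangentSpace 𝓘(ℝ, E) x →L[ℝ] V} (hθ : IsSmoothForm θ)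
    {θ' : ∀ x : X', TangentSpace 𝓘(ℝ, E') x →L[ℝ] V}
    {f : X' → X} (hf : ContMDiff 𝓘(ℝ, E') 𝓘(ℝ, E) ∞ f)
    (hff : ∀ x (v : TangentSpace 𝓘(ℝ, E') x),
      θ' x v = θ (f x) (mfderiv 𝓘(ℝ, E') 𝓘(ℝ, E) f x v))
    (x : X') (a b : TangentSpace 𝓘(ℝ, E') x) :
    extD θ' x a b = extD θ (f x) (mfderiv 𝓘(ℝ, E') 𝓘(ℝ, E) f x a)
      (mfderiv 𝓘(ℝ, E') 𝓘(ℝ, E) f x b) := by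
  set z := extChartAt 𝓘(ℝ, E') x x with hz
  set F : E' → E := extChartAt 𝓘(ℝ, E) (f x) ∘ f ∘ (extChartAt 𝓘(ℝ, E') x).symm with hF
  have hFz : F z = extChartAt 𝓘(ℝ, E) (f x) (f x) := by
    simp only [hF, hz, Function.comp_apply, extChartAt_to_inv]
  have hFsm : ContDiffAt ℝ ∞ F z := by
    have h := (contMDiffAt_iff.1 (hf x)).2
    rw [modelWithCornersSelf_coe, range_id, contDiffWithinAt_univ] at h
    exact h
  have hdF : mfderiv 𝓘(ℝ, E') 𝓘(ℝ, E) f x = fderiv ℝ F z := by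
    rw [((hf x).mdifferentiableAt (by simp)).mfderiv, modelWithCornersSelf_coe, range_id,
      fderivWithin_univ]
    rfl
  have hcont : Tendsto (extChartAt 𝓘(ℝ, E') x).symm (𝓝 z) (𝓝 x) := by
    have h := continuousAt_extChartAt_symm (I := 𝓘(ℝ, E')) x
    rwa [ContinuousAt, extChartAt_to_inv] at h
  have hsrc : ∀ᶠ w in 𝓝 z, f ((extChartAt 𝓘(ℝ, E') x).symm w) ∈
      (extChartAt 𝓘(ℝ, E) (f x)).source :=
    hcont.eventually ((hf.continuous.continuousAt (x := x)).eventually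
      (extChartAt_source_mem_nhds (I := 𝓘(ℝ, E)) (f x)))
  have hFdiff : ∀ᶠ w in 𝓝 z, DifferentiableAt ℝ F w := by
    filter_upwards [(hFsm.of_le (m := 1) (by simp)).eventually (by simp)] with w hw
    exact hw.differentiableAt (by simp)
  -- The pullback relation is needed on a neighbourhood of `z`, since it is about to be
  -- differentiated.
  have hloc : localForm θ' x =ᶠ[𝓝 z] fun w => (localForm θ (f x) (F w)).comp (fderiv ℝ F w) := by
    filter_upwards [hsrc, hsrc.eventually_nhds, hFdiff,
      extChartAt_target_mem_nhds (I := 𝓘(ℝ, E')) x] with w hw hw' hFw hwt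
    have e1 : (extChartAt 𝓘(ℝ, E) (f x)).symm (F w) = f ((extChartAt 𝓘(ℝ, E') x).symm w) :=
      (extChartAt 𝓘(ℝ, E) (f x)).left_inv hw
    have e2 : (extChartAt 𝓘(ℝ, E) (f x)).symm ∘ F =ᶠ[𝓝 w]
        f ∘ (extChartAt 𝓘(ℝ, E') x).symm := by
      filter_upwards [hw'] with y hy
      exact (extChartAt 𝓘(ℝ, E) (f x)).left_inv hy
    have e3 := e2.mfderiv_eq (I := 𝓘(ℝ, E')) (I' := 𝓘(ℝ, E))
    have hFt : F w ∈ (extChartAt 𝓘(ℝ, E) (f x)).target :=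
      (extChartAt 𝓘(ℝ, E) (f x)).map_source hw
    rw [mfderiv_comp w (mdifferentiableAt_extChartAt_symm hFt) hFw.mdifferentiableAt,
      mfderiv_comp w ((hf _).mdifferentiableAt (by simp)) (mdifferentiableAt_extChartAt_symm hwt),
      mfderiv_eq_fderiv] at e3
    ext v
    have key : ∀ (y y' : X) (u u' : E), y = y' → u = u' → θ y u = θ y' u' := by
      rintro y y' u u' rfl rfl; rfl
    refine (hff _ _).trans ?_
    exact key _ _ _ _ e1.symm (DFunLike.congr_fun e3 v).symm
  have hd1 : HasFDerivAt F (fderiv ℝ F z) z := (hFsm.differentiableAt (by simp)).hasFDerivAt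
  have hd2 : HasFDerivAt (fderiv ℝ F) (fderiv ℝ (fderiv ℝ F) z) z :=
    ((hFsm.fderiv_right (m := ∞) (by simp)).differentiableAt (by simp)).hasFDerivAt
  have hd3 : HasFDerivAt (localForm θ (f x)) (fderiv ℝ (localForm θ (f x)) (F z)) (F z) := by
    rw [hFz]; exact (differentiableAt_localForm hθ (f x)).hasFDerivAt
  have hd4 := ((hd3.comp z hd1).clm_comp hd2).fderiv
  -- The second derivative of `F` is symmetric, so its contribution drops out on antisymmetrizing.
  have hsymm : IsSymmSndFDerivAt ℝ F z := hFsm.isSymmSndFDerivAt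
    (by rw [minSmoothness_of_isRCLikeNormedField]; exact ENat.LEInfty.out)
  have hval : ∀ a b : E', fderiv ℝ (localForm θ' x) z a b =
      localForm θ (f x) (F z) (fderiv ℝ (fderiv ℝ F) z a b) +
      fderiv ℝ (localForm θ (f x)) (F z) (fderiv ℝ F z a) (fderiv ℝ F z b) := by
    intro a b
    rw [hloc.fderiv_eq]
    exact DFunLike.congr_fun (DFunLike.congr_fun hd4 a) b
  rw [extD, extD, ← hz, hval a b, hval b a, hsymm.eq a b, hdF, hFz]
  abel

end LocalForm

/-! ### Kernels of surjective forms are subbundles. -/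

section Regular

variable {E : Type*} [NormedAddCommGroup E] [NormedSpace ℝ E]
  {V : Type*} [NormedAddCommGroup V] [NormedSpace ℝ V]

/-- A smooth family of surjective linear maps has a smooth local frame of kernels. -/
lemma exists_local_frame_ker [FiniteDimensional ℝ E] [FiniteDimensional ℝ V] {L : E → E →L[ℝ] V}
    {T : Set E} (hT : IsOpen T) (hL : ContDiffOn ℝ ∞ L T) {z₀ : E} (hz₀ : z₀ ∈ T)
    (hsurj : Function.Surjective (L z₀)) :
    ∃ W ⊆ T, IsOpen W ∧ z₀ ∈ W ∧
      ∃ u : Fin (Module.finrank ℝ E - Module.finrank ℝ V) → E → E,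
        (∀ i, ContDiffOn ℝ ∞ (u i) W) ∧
        ∀ z ∈ W, LinearIndependent ℝ (fun i => u i z) ∧ ∀ i, L z (u i z) = 0 := by
  have : CompleteSpace V := FiniteDimensional.complete ℝ V
  obtain ⟨s', hs'⟩ := (L z₀ : E →ₗ[ℝ] V).exists_rightInverse_of_surjective
    (LinearMap.range_eq_top.2 hsurj)
  set s : V →L[ℝ] E := LinearMap.toContinuousLinearMap s' with hs_def
  have hs : ∀ v, L z₀ (s v) = v := fun v => LinearMap.congr_fun hs' v
  have hk : Module.finrank ℝ (L z₀ : E →ₗ[ℝ] V).ker =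
      Module.finrank ℝ E - Module.finrank ℝ V := by
    have h := (L z₀ : E →ₗ[ℝ] V).finrank_range_add_finrank_ker
    rw [LinearMap.range_eq_top.2 hsurj, finrank_top] at h
    omega
  let b := Module.finBasisOfFinrankEq ℝ (L z₀ : E →ₗ[ℝ] V).ker hk
  have hb : ∀ i, L z₀ (b i : E) = 0 := fun i => (b i).2
  -- `A z₀` is the identity because `s` splits `L z₀`, and invertibility is an open condition: this
  -- gives `W`.
  let A : E → V →L[ℝ] V := fun z => (L z).comp s
  have hA : ContDiffOn ℝ ∞ A T := hL.clm_comp contDiffOn_const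
  have hA₀ : A z₀ = ContinuousLinearEquiv.refl ℝ V := by
    ext v; exact hs v
  let W : Set E := T ∩ A ⁻¹' (range ((↑) : (V ≃L[ℝ] V) → V →L[ℝ] V))
  have hW : IsOpen W := hA.continuousOn.isOpen_inter_preimage hT ContinuousLinearEquiv.isOpen
  -- The frame is a basis of `ker (L z₀)`, projected onto `ker (L z)` along the range of `s`.
  refine ⟨W, inter_subset_left, hW, ⟨hz₀, ContinuousLinearEquiv.refl ℝ V, hA₀.symm⟩,
    fun i z => (b i : E) - s ((A z).inverse (L z (b i))), ?_, ?_⟩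
  · intro i
    have h1 : ContDiffOn ℝ ∞ (fun z => (A z).inverse) W := by
      rintro z ⟨hz, e, he⟩
      have h : ContDiffAt ℝ ∞ ContinuousLinearMap.inverse (A z) := by
        rw [← he]; exact contDiffAt_map_inverse e
      exact h.comp_contDiffWithinAt z ((hA z hz).mono inter_subset_left)
    exact contDiffOn_const.sub (s.contDiff.comp_contDiffOn
      (h1.clm_apply ((hL.mono inter_subset_left).clm_apply contDiffOn_const)))
  · rintro z ⟨hz, e, he⟩
    refine ⟨?_, fun i => ?_⟩
    · rw [Fintype.linearIndependent_iff]
      intro c hc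
      have h1 : ∑ i, c i • (b i : E) = s (∑ i, c i • (A z).inverse (L z (b i))) := by
        simp only [smul_sub, Finset.sum_sub_distrib] at hc
        rw [sub_eq_zero.1 hc, map_sum]
        simp only [map_smul]
      -- `L z₀` kills each `b i` and undoes `s`, so the correction term vanishes and only a relation
      -- among the `b i` remains.
      have h2 := congrArg (L z₀) h1
      rw [hs, map_sum] at h2
      simp only [map_smul, hb, smul_zero, Finset.sum_const_zero] at h2
      rw [← h2, map_zero] at h1
      refine Fintype.linearIndependent_iff.1 b.linearIndependent c ?_
      apply Subtype.ext
      simpa using h1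
    · have h1 : A z ((A z).inverse (L z (b i))) = L z (b i) :=
        ContinuousLinearMap.IsInvertible.self_apply_inverse ⟨e, he⟩ _
      rw [map_sub]
      exact sub_eq_zero.2 h1.symm

variable {X : Type*} [TopologicalSpace X] [ChartedSpace E X] [IsManifold 𝓘(ℝ, E) ∞ X]

/-- The vector field on the domain of the preferred chart at `x` given in the chart by `u`. -/
def fieldOfChart (x : X) (u : E → E) (y : X) : TangentSpace 𝓘(ℝ, E) y :=
  (chartSymmDeriv x (extChartAt 𝓘(ℝ, E) x y) (u (extChartAt 𝓘(ℝ, E) x y)) : E)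

lemma isSmoothFieldOn_fieldOfChart (x : X) {u : E → E} {W : Set E}
    (hWT : W ⊆ (extChartAt 𝓘(ℝ, E) x).target) (hu : ContDiffOn ℝ ∞ u W) :
    IsSmoothFieldOn (fieldOfChart x u)
      ((extChartAt 𝓘(ℝ, E) x).source ∩ extChartAt 𝓘(ℝ, E) x ⁻¹' W) := by
  have hs := (isOpen_extChartAt_target (I := 𝓘(ℝ, E)) x).uniqueMDiffOn (I := 𝓘(ℝ, E))
  have h1 := (contMDiffOn_extChartAt_symm (I := 𝓘(ℝ, E)) (n := ∞) x).contMDiffOn_tangentMapWithin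
    (m := ∞) (by simp) hs
  have h2 : ContMDiffOn 𝓘(ℝ, E) 𝓘(ℝ, E).tangent ∞
      (fun z : E => (⟨z, u z⟩ : TangentBundle 𝓘(ℝ, E) E)) W :=
    contMDiffOn_vectorSpace_iff_contDiffOn.2 hu
  have h3 : ContMDiffOn 𝓘(ℝ, E) 𝓘(ℝ, E) ∞ (extChartAt 𝓘(ℝ, E) x)
      ((extChartAt 𝓘(ℝ, E) x).source ∩ extChartAt 𝓘(ℝ, E) x ⁻¹' W) :=
    (contMDiffOn_extChartAt (I := 𝓘(ℝ, E)) (n := ∞)).mono fun y hy => by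
      rw [← extChartAt_source 𝓘(ℝ, E)]; exact hy.1
  have h4 := (h1.comp h2 fun z hz => hWT hz).comp h3 fun y hy => hy.2
  refine h4.congr fun y hy => ?_
  simp only [Function.comp_apply, tangentMapWithin]
  rw [mfderivWithin_eq_mfderiv (hs _ (hWT hy.2)) (mdifferentiableAt_extChartAt_symm (hWT hy.2))]
  have key : ∀ (y y' : X) (e : E), y = y' →
      (⟨y, e⟩ : TangentBundle 𝓘(ℝ, E) X) = ⟨y', e⟩ := by
    rintro y y' e rfl; rfl
  exact key _ _ _ ((extChartAt 𝓘(ℝ, E) x).left_inv hy.1).symm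

/-- The kernel of a smooth pointwise surjective one-form is a regular distribution. -/
lemma isRegularDistribution_ker [FiniteDimensional ℝ E] [FiniteDimensional ℝ V]
    {θ : ∀ x : X, TangentSpace 𝓘(ℝ, E) x →L[ℝ] V} (hθ : IsSmoothForm θ)
    (hsurj : ∀ x, Function.Surjective (θ x)) :
    IsRegularDistribution fun x => (θ x).ker := by
  refine ⟨Module.finrank ℝ E - Module.finrank ℝ V, fun x => ?_⟩
  have hsurj' : Function.Surjective (localForm θ x (extChartAt 𝓘(ℝ, E) x x)) := fun v => by
    obtain ⟨a, ha⟩ := hsurj x v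
    exact ⟨a, (localForm_self θ x a).trans ha⟩
  obtain ⟨W, hWT, hW, hxW, u, hu, hu'⟩ := exists_local_frame_ker (isOpen_extChartAt_target x)
    (contDiffOn_localForm hθ x) (mem_extChartAt_target x) hsurj'
  refine ⟨(extChartAt 𝓘(ℝ, E) x).source ∩ extChartAt 𝓘(ℝ, E) x ⁻¹' W,
    (continuousOn_extChartAt x).isOpen_inter_preimage (isOpen_extChartAt_source x) hW,
    ⟨mem_extChartAt_source x, hxW⟩, fun i => fieldOfChart x (u i),
    fun i => isSmoothFieldOn_fieldOfChart x hWT (hu i), fun y hy => ?_⟩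
  have : FiniteDimensional ℝ (TangentSpace 𝓘(ℝ, E) y) := inferInstanceAs (FiniteDimensional ℝ E)
  obtain ⟨hli, hker⟩ := hu' _ hy.2
  have hli' : LinearIndependent ℝ (fun i => fieldOfChart x (u i) y) := by
    obtain ⟨e, he⟩ := chartSymmDeriv_isInvertible (hWT hy.2)
    have h := hli.map' e.toLinearEquiv.toLinearMap e.toLinearEquiv.ker
    refine Eq.mp ?_ h
    congr 1
    funext i
    exact DFunLike.congr_fun he (u i (extChartAt 𝓘(ℝ, E) x y))
  have key : ∀ (y y' : X) (e : E), y = y' → θ y e = θ y' e := by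
    rintro y y' e rfl; rfl
  -- The frame lies in the kernel; rank-nullity for the surjective `θ y` shows that it fills it.
  refine ⟨hli', Submodule.eq_of_le_of_finrank_eq ?_ ?_⟩
  · rw [Submodule.span_le]
    rintro _ ⟨i, rfl⟩
    exact (key _ _ _ ((extChartAt 𝓘(ℝ, E) x).left_inv hy.1).symm).trans (hker i)
  · rw [finrank_span_eq_card hli', Fintype.card_fin]
    have h := (θ y : TangentSpace 𝓘(ℝ, E) y →ₗ[ℝ] V).finrank_range_add_finrank_ker
    rw [LinearMap.range_eq_top.2 (hsurj y), finrank_top] at h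
    have h2 : Module.finrank ℝ (TangentSpace 𝓘(ℝ, E) y) = Module.finrank ℝ E := rfl
    change _ = Module.finrank ℝ (θ y : TangentSpace 𝓘(ℝ, E) y →ₗ[ℝ] V).ker
    omega

end Regular

/-! ### Left invariant vector fields. -/

section LieGroup

variable {EG : Type*} [NormedAddCommGroup EG] [NormedSpace ℝ EG]
  {G : Type*} [Group G] [TopologicalSpace G] [ChartedSpace EG G]

lemma mulInvariantVectorField_one (α : GroupLieAlgebra 𝓘(ℝ, EG) G) :
    mulInvariantVectorField α (1 : G) = α := by
  have h : (fun b : G => 1 * b) = id := funext one_mul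
  change (mfderiv 𝓘(ℝ, EG) 𝓘(ℝ, EG) (fun b : G => 1 * b) 1 α : EG) = α
  rw [h, mfderiv_id]
  rfl

variable [LieGroup 𝓘(ℝ, EG) ∞ G]

/-- Left invariant vector fields on a smooth Lie group are smooth. -/
lemma contMDiff_infty_mulInvariantVectorField (α : GroupLieAlgebra 𝓘(ℝ, EG) G) :
    ContMDiff 𝓘(ℝ, EG) 𝓘(ℝ, EG).tangent ∞
      (fun g : G => (⟨g, mulInvariantVectorField α g⟩ : TangentBundle 𝓘(ℝ, EG) G)) := by
  have : IsManifold 𝓘(ℝ, EG) ∞ G := inferInstance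
  have : IsManifold 𝓘(ℝ, EG) 1 G := IsManifold.of_le (n := ∞) (by simp)
  -- The field at `g` is the tangent map of the multiplication applied to `(0, α)` at `(g, 1)`.
  have h₁ : ContMDiff 𝓘(ℝ, EG) (𝓘(ℝ, EG).tangent.prod 𝓘(ℝ, EG).tangent) ∞
      (fun g : G => ((⟨g, 0⟩, ⟨1, α⟩) : TangentBundle 𝓘(ℝ, EG) G × TangentBundle 𝓘(ℝ, EG) G)) :=
    (Bundle.contMDiff_zeroSection _ _).prodMk contMDiff_const
  have h₂ := contMDiff_equivTangentBundleProd_symm (n := ∞) (I := 𝓘(ℝ, EG)) (M := G)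
    (I' := 𝓘(ℝ, EG)) (M' := G)
  have h₃ := (contMDiff_mul 𝓘(ℝ, EG) (G := G) ∞).contMDiff_tangentMap (m := ∞) (by simp)
  refine ((h₃.comp h₂).comp h₁).congr fun g => ?_
  have h := mfderiv_prod_eq_add_apply (p := ((g, 1) : G × G)) (v := ((0, α) : EG × EG))
    ((contMDiff_mul 𝓘(ℝ, EG) (G := G) ∞).mdifferentiableAt (by simp))
  have key : ∀ (y y' : G) (e e' : EG), y = y' → e = e' →
      (⟨y, e⟩ : TangentBundle 𝓘(ℝ, EG) G) = ⟨y', e'⟩ := by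
    rintro y y' e e' rfl rfl; rfl
  refine key _ _ _ _ (mul_one g).symm ?_
  refine Eq.trans ?_ h.symm
  have h0 : (mfderiv 𝓘(ℝ, EG) 𝓘(ℝ, EG) (fun z : G => z * 1) g) (0 : EG) = 0 := map_zero _
  refine Eq.trans ?_ (congrArg (· + _) h0.symm)
  exact (zero_add _).symm

/-- Translate `v` back to the identity by `g⁻¹`. This reduces the multiplicativity of a form to left
invariant vectors. -/
lemma exists_eq_mulInvariantVectorField (g : G) (v : TangentSpace 𝓘(ℝ, EG) g) :
    ∃ α : GroupLieAlgebra 𝓘(ℝ, EG) G, mulInvariantVectorField α g = v := by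
  refine ⟨(mfderiv 𝓘(ℝ, EG) 𝓘(ℝ, EG) (fun k : G => g⁻¹ * k) g v : EG), ?_⟩
  have h := mfderiv_comp (I := 𝓘(ℝ, EG)) (I' := 𝓘(ℝ, EG)) (I'' := 𝓘(ℝ, EG)) g
    ((contMDiff_mul_left (I := 𝓘(ℝ, EG)) (n := ∞) (a := g) (g⁻¹ * g)).mdifferentiableAt (by simp))
    ((contMDiff_mul_left (I := 𝓘(ℝ, EG)) (n := ∞) (a := g⁻¹) g).mdifferentiableAt (by simp))
  have h3 : (fun k : G => g * k) ∘ (fun k : G => g⁻¹ * k) = id := by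
    funext k; exact mul_inv_cancel_left g k
  rw [h3, mfderiv_id] at h
  have k1 : ∀ (k : G) (e : EG), k = 1 →
      (mfderiv 𝓘(ℝ, EG) 𝓘(ℝ, EG) (fun b : G => g * b) k e : EG) =
        mfderiv 𝓘(ℝ, EG) 𝓘(ℝ, EG) (fun b : G => g * b) 1 e := by
    rintro k e rfl; rfl
  exact (k1 _ _ (inv_mul_cancel g)).symm.trans (DFunLike.congr_fun h v).symm

end LieGroup

/-! ### Differentials of the action; orbit maps are immersions. -/

section Bundle

variable {EG : Type*} [NormedAddCommGroup EG] [NormedSpace ℝ EG]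
  {G : Type*} [Group G] [TopologicalSpace G] [ChartedSpace EG G]
  {EM : Type*} [NormedAddCommGroup EM] [NormedSpace ℝ EM]
  {M : Type*} [TopologicalSpace M] [ChartedSpace EM M]

namespace PrincipalBundle

variable (P : PrincipalBundle.{u, v} EG G EM M)

/-- The differential at `g` of the orbit map `g ↦ g • p`. -/
def dOrbit (p : P) (g : G) : TangentSpace 𝓘(ℝ, EG) g →L[ℝ] P.T (g • p) :=
  mfderiv 𝓘(ℝ, EG) 𝓘(ℝ, P.E) (fun g : G => g • p) g

lemma contMDiff_orbit (p : P) :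
    ContMDiff 𝓘(ℝ, EG) 𝓘(ℝ, P.E) ∞ (fun g : G => g • p) :=
  (P.smooth_action.contMDiff_smul).comp (contMDiff_id.prodMk contMDiff_const)

lemma contMDiff_act (g : G) :
    ContMDiff 𝓘(ℝ, P.E) 𝓘(ℝ, P.E) ∞ (fun p : P => g • p) :=
  (P.smooth_action.contMDiff_smul).comp (contMDiff_const.prodMk contMDiff_id)

lemma mfderiv_smul_apply (g : G) (p : P) (v : TangentSpace 𝓘(ℝ, EG) g) (w : P.T p) :
    (mfderiv (𝓘(ℝ, EG).prod 𝓘(ℝ, P.E)) 𝓘(ℝ, P.E) (fun x : G × P => x.1 • x.2) (g, p)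
      ((v, w) : EG × P.E)) = P.dOrbit p g v + P.dAct g p w :=
  mfderiv_prod_eq_add_apply (p := ((g, p) : G × P)) (v := ((v, w) : EG × P.E))
    ((P.smooth_action.contMDiff_smul).mdifferentiableAt (by simp))

lemma dAct_inv_dAct (g : G) (p : P) (w : P.T p) :
    (P.dAct g⁻¹ (g • p) (P.dAct g p w) : P.E) = w := by
  have h := mfderiv_comp (I := 𝓘(ℝ, P.E)) (I' := 𝓘(ℝ, P.E)) (I'' := 𝓘(ℝ, P.E)) p
    (((P.contMDiff_act g⁻¹) (g • p)).mdifferentiableAt (by simp))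
    (((P.contMDiff_act g) p).mdifferentiableAt (by simp))
  have h2 : (fun q : P => g⁻¹ • q) ∘ (fun q : P => g • q) = id := by
    funext q; exact inv_smul_smul g q
  rw [h2, mfderiv_id] at h
  exact (DFunLike.congr_fun h w).symm

lemma dAct_dAct_inv (g : G) (p : P) (w : P.T (g • p)) :
    P.dAct g p ((P.dAct g⁻¹ (g • p) w : P.E)) = w := by
  have h := P.dAct_inv_dAct g⁻¹ (g • p) w
  have key : ∀ (k : G) (q : P) (e : P.E), k = g → q = p →
      (P.dAct k q e : P.E) = P.dAct g p e := by
    rintro k q e rfl rfl; rfl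
  exact (key _ _ _ (inv_inv g) (inv_smul_smul g p)).symm.trans h

end PrincipalBundle

namespace PrincipalBundle

variable [LieGroup 𝓘(ℝ, EG) ∞ G] (P : PrincipalBundle.{u, v} EG G EM M)

/-- Differentiate `(g * k) • p = g • (k • p)` in `k` at `k = 1`. -/
lemma dOrbit_mulInvariantVectorField (p : P) (g : G) (α : GroupLieAlgebra 𝓘(ℝ, EG) G) :
    P.dOrbit p g (mulInvariantVectorField α g) = P.dAct g p (P.fundamental α p) := by
  have h1 := mfderiv_comp (I := 𝓘(ℝ, EG)) (I' := 𝓘(ℝ, EG)) (I'' := 𝓘(ℝ, P.E)) (1 : G)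
    (((P.contMDiff_orbit p) (g * 1)).mdifferentiableAt (by simp))
    ((contMDiff_mul_left (I := 𝓘(ℝ, EG)) (n := ∞) (a := g) (1 : G)).mdifferentiableAt (by simp))
  have h2 := mfderiv_comp (I := 𝓘(ℝ, EG)) (I' := 𝓘(ℝ, P.E)) (I'' := 𝓘(ℝ, P.E)) (1 : G)
    (((P.contMDiff_act g) ((1 : G) • p)).mdifferentiableAt (by simp))
    (((P.contMDiff_orbit p) 1).mdifferentiableAt (by simp))
  have h3 : (fun k : G => k • p) ∘ (fun k : G => g * k) =
      (fun q : P => g • q) ∘ (fun k : G => k • p) := by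
    funext k; exact mul_smul g k p
  have k1 : ∀ (k : G) (e : EG), k = g → (P.dOrbit p k e : P.E) = P.dOrbit p g e := by
    rintro k e rfl; rfl
  have k2 : ∀ (q : P) (e : P.E), q = p → (P.dAct g q e : P.E) = P.dAct g p e := by
    rintro q e rfl; rfl
  have h4 : (mfderiv 𝓘(ℝ, EG) 𝓘(ℝ, P.E) ((fun k : G => k • p) ∘ (fun k : G => g * k)) 1 α : P.E) =
      mfderiv 𝓘(ℝ, EG) 𝓘(ℝ, P.E) ((fun q : P => g • q) ∘ (fun k : G => k • p)) 1 α := by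
    rw [h3]
  have h5 := DFunLike.congr_fun h1 α
  have h6 := DFunLike.congr_fun h2 α
  exact (k1 _ _ (mul_one g)).symm.trans (h5.symm.trans (h4.trans (h6.trans (k2 _ _ (one_smul G p)))))

/-- The action being free, the orbit map is an immersion. -/
lemma dOrbit_one_injective [CompleteSpace EG] (p : P) :
    Function.Injective (P.dOrbit p 1) := by
  have : IsManifold 𝓘(ℝ, EG) 1 G := IsManifold.of_le (n := ∞) (by simp)
  have : IsManifold 𝓘(ℝ, P.E) 1 P := IsManifold.of_le (n := ∞) (by simp)
  rw [injective_iff_map_eq_zero]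
  intro α hα
  -- If `α† = 0` at `p`, then along the integral curve `γ` of the left invariant field the point `γ
  -- t • p` has zero velocity. It is therefore constant, freeness forces `γ = 1` near `0`, and so `α
  -- = 0`.
  obtain ⟨γ, hγ0, hγ⟩ := exists_isMIntegralCurveAt_of_contMDiffAt_boundaryless (t₀ := 0)
    ((contMDiff_infty_mulInvariantVectorField α (1 : G)).of_le (by simp))
  have hγp : IsMIntegralCurveAt (fun t => γ t • p)
      (fun q => (0 : TangentSpace 𝓘(ℝ, P.E) q)) 0 := by
    filter_upwards [hγ] with t ht
    have h1 := HasMFDerivAt.comp t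
      (((P.contMDiff_orbit p) (γ t)).mdifferentiableAt (by simp)).hasMFDerivAt ht
    have h2 : P.dOrbit p (γ t) (mulInvariantVectorField α (γ t)) = 0 := by
      rw [P.dOrbit_mulInvariantVectorField, show P.fundamental α p = 0 from hα, map_zero]
    have h3 : P.dOrbit p (γ t) ((1 : ℝ) • mulInvariantVectorField α (γ t)) = 0 := by
      rw [one_smul, h2]
    refine h1.congr_mfderiv ?_
    ext
    exact Eq.trans h3 (smul_zero (1 : ℝ)).symm
  have hp : IsMIntegralCurveAt (fun _ : ℝ => p) (fun q => (0 : TangentSpace 𝓘(ℝ, P.E) q)) 0 := by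
    refine Eventually.of_forall fun t => ?_
    refine (hasMFDerivAt_const (I := 𝓘(ℝ, ℝ)) (I' := 𝓘(ℝ, P.E)) p t).congr_mfderiv ?_
    ext
    exact (smul_zero (1 : ℝ)).symm
  have heq := isMIntegralCurveAt_eventuallyEq_of_contMDiffAt_boundaryless
    (Bundle.contMDiff_zeroSection ℝ (TangentSpace 𝓘(ℝ, P.E))).contMDiffAt hγp hp
    (by simp [hγ0])
  have hγ1 : γ =ᶠ[𝓝 0] fun _ => 1 := by
    filter_upwards [heq] with t ht
    exact P.free _ _ ht
  have h0 := hγ.self_of_nhds.mfderiv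
  rw [hγ1.mfderiv_eq, mfderiv_const] at h0
  have h1 := (DFunLike.congr_fun h0 (1 : ℝ)).symm
  have h2 : (mulInvariantVectorField α (γ 0) : EG) = 0 := (one_smul ℝ _).symm.trans h1
  have key : ∀ g : G, g = 1 → (mulInvariantVectorField α g : EG) = α := by
    rintro g rfl
    exact mulInvariantVectorField_one α
  exact (key _ hγ0).symm.trans h2

end PrincipalBundle
end Bundle

/-! ### Vertical vectors are fundamental: the dimension of the fibre. -/

section Vertical

variable {EG : Type*} [NormedAddCommGroup EG] [NormedSpace ℝ EG]
  {G : Type*} [Group G] [TopologicalSpace G] [ChartedSpace EG G]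
  {EM : Type*} [NormedAddCommGroup EM] [NormedSpace ℝ EM]
  {M : Type*} [TopologicalSpace M] [ChartedSpace EM M]

namespace PrincipalBundle

variable (P : PrincipalBundle.{u, v} EG G EM M)

/-- Properness makes `(g, q) ↦ (g • q, q)` closed; restrict to the slice `q = p`. -/
lemma isClosedMap_orbit (p : P) : IsClosedMap (fun g : G => g • p) := by
  intro K hK
  have h1 := P.proper.isProperMap_smul_pair.isClosedMap _ (hK.prod (isClosed_singleton (x := p)))
  have h2 := h1.preimage (Continuous.prodMk_left p : Continuous fun q : P => (q, p))
  convert! h2 using 1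
  ext q
  constructor
  · rintro ⟨g, hg, rfl⟩
    exact ⟨(g, p), ⟨hg, rfl⟩, rfl⟩
  · rintro ⟨⟨g, p'⟩, ⟨hg, hp'⟩, h⟩
    obtain rfl : p' = p := hp'
    exact ⟨g, hg, congrArg Prod.fst h⟩

/-- The fibre of a principal bundle is locally the image of the group under a smooth map, hence has
at most the dimension of the group. -/
lemma finrank_complement_le [FiniteDimensional ℝ EG] [IsManifold 𝓘(ℝ, EG) ∞ G] {p : P}
    {F : Type*} [NormedAddCommGroup F] [NormedSpace ℝ F] [FiniteDimensional ℝ F]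
    (h : Manifold.IsSubmersionAtOfComplement F 𝓘(ℝ, P.E) 𝓘(ℝ, EM) ∞ P.π p) :
    Module.finrank ℝ F ≤ Module.finrank ℝ EG := by
  set dom := h.domChart.extend 𝓘(ℝ, P.E) with hdom
  have hpdom : p ∈ dom.source := by
    rw [hdom, OpenPartialHomeomorph.extend_source]; exact h.mem_domChart_source
  let q : P → F := fun y => (h.equiv (dom y)).2
  let ψ := extChartAt 𝓘(ℝ, EG) (1 : G)
  -- `Q` is the orbit map read in a chart of `G` and in the fibre coordinate of the submersion
  -- chart.
  let Q : EG → F := fun z => q (ψ.symm z • p)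
  have hψ1 : ψ.symm (ψ 1) = 1 := extChartAt_to_inv (I := 𝓘(ℝ, EG)) (1 : G)
  have hq : ContMDiffAt 𝓘(ℝ, P.E) 𝓘(ℝ, F) ∞ q p := by
    have h1 : ContMDiffAt 𝓘(ℝ, P.E) 𝓘(ℝ, P.E) ∞ dom p :=
      h.domChart.contMDiffAt_extend h.domChart_mem_maximalAtlas h.mem_domChart_source
    have h2 : ContDiff ℝ ∞ (fun e : P.E => (h.equiv e).2) :=
      contDiff_snd.comp h.equiv.contDiff
    exact h2.contMDiff.contMDiffAt.comp p h1
  have hQ : ContDiffAt ℝ ∞ Q (ψ 1) := by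
    rw [← contMDiffAt_iff_contDiffAt]
    have h1 : ContMDiffAt 𝓘(ℝ, EG) 𝓘(ℝ, EG) ∞ ψ.symm (ψ 1) :=
      (contMDiffOn_extChartAt_symm (I := 𝓘(ℝ, EG)) (n := ∞) (1 : G)).contMDiffAt
        (extChartAt_target_mem_nhds (I := 𝓘(ℝ, EG)) (1 : G))
    have h2 : ContMDiffAt 𝓘(ℝ, EG) 𝓘(ℝ, P.E) ∞ (fun z => ψ.symm z • p) (ψ 1) :=
      ((P.contMDiff_orbit p) _).comp (ψ 1) h1
    refine ContMDiffAt.comp (I' := 𝓘(ℝ, P.E)) (ψ 1) (g := q) ?_ h2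
    rw [hψ1, one_smul]
    exact hq
  obtain ⟨B', hB', hQB'⟩ := hQ.contDiffOn (m := 1) (by simp) (by simp)
  obtain ⟨r, hr, hrB⟩ := Metric.mem_nhds_iff.1
    (inter_mem hB' (extChartAt_target_mem_nhds (I := 𝓘(ℝ, EG)) (1 : G)))
  -- A ball, because the Hausdorff dimension bound below is applied on a convex set.
  set B := Metric.ball (ψ 1) r with hB
  have hQB : ContDiffOn ℝ 1 Q B := hQB'.mono fun z hz => (hrB hz).1
  let N : Set G := ψ.source ∩ ψ ⁻¹' B
  have hN : IsOpen N := (continuousOn_extChartAt (I := 𝓘(ℝ, EG)) (1 : G)).isOpen_inter_preimage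
    (isOpen_extChartAt_source (I := 𝓘(ℝ, EG)) (1 : G)) Metric.isOpen_ball
  have h1N : (1 : G) ∈ N := ⟨mem_extChartAt_source _, Metric.mem_ball_self hr⟩
  -- Group elements outside `N` move `p` into a closed set which, by freeness, misses `p`. Fibre
  -- points close to `p` are therefore reached from `N` alone, so no countability of `G` is needed.
  have hC : IsClosed ((fun g : G => g • p) '' Nᶜ) := P.isClosedMap_orbit p _ hN.isClosed_compl
  have hpC : p ∉ (fun g : G => g • p) '' Nᶜ := by
    rintro ⟨g, hg, hgp⟩
    exact hg (P.free g p hgp ▸ h1N)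
  -- The slice with the base coordinate of `p`, which is the fibre in the submersion chart.
  let S : F → P.E := fun f => h.equiv.symm ((h.equiv (dom p)).1, f)
  have hS : Continuous S := h.equiv.symm.continuous.comp (Continuous.prodMk_right _)
  have hSp : S (q p) = dom p := h.equiv.symm_apply_apply _
  have hdt : dom.target ∈ 𝓝 (S (q p)) := by
    rw [hSp]
    have h1 := h.domChart.extend_target_mem_nhdsWithin (I := 𝓘(ℝ, P.E)) h.mem_domChart_source
    rwa [modelWithCornersSelf_coe, range_id, nhdsWithin_univ] at h1
  have hdc : Tendsto dom.symm (𝓝 (S (q p))) (𝓝 p) := by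
    rw [hSp]
    have h1 := h.domChart.continuousAt_extend_symm (I := 𝓘(ℝ, P.E)) h.mem_domChart_source
    rwa [ContinuousAt, OpenPartialHomeomorph.extend_left_inv _ h.mem_domChart_source] at h1
  have himage : Q '' B ∈ 𝓝 (q p) := by
    filter_upwards [hS.continuousAt.eventually hdt,
      hS.continuousAt.eventually (hdc.eventually (hC.isOpen_compl.mem_nhds hpC))] with f hf hfC
    have e1 : (h.codChart.extend 𝓘(ℝ, EM)) (P.π (dom.symm (S f))) = (h.equiv (S f)).1 :=
      h.writtenInCharts hf
    have e2 : (h.codChart.extend 𝓘(ℝ, EM)) (P.π (dom.symm (dom p))) = (h.equiv (dom p)).1 :=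
      h.writtenInCharts (dom.map_source hpdom)
    have e3 : (h.equiv (S f)) = ((h.equiv (dom p)).1, f) := h.equiv.apply_symm_apply _
    rw [dom.left_inv hpdom] at e2
    rw [e3, ← e2] at e1
    have hsrc : dom.symm (S f) ∈ h.domChart.source := by
      have := dom.map_target hf
      rwa [hdom, OpenPartialHomeomorph.extend_source] at this
    have e4 : P.π (dom.symm (S f)) = P.π p := by
      refine (h.codChart.extend 𝓘(ℝ, EM)).injOn ?_ ?_ e1
      · rw [OpenPartialHomeomorph.extend_source]; exact h.source_subset_preimage_source hsrc
      · rw [OpenPartialHomeomorph.extend_source]; exact h.mem_codChart_source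
    obtain ⟨g, hg⟩ := P.transitive p _ e4.symm
    have hgN : g ∈ N := by
      by_contra hgN
      exact hfC ⟨g, hgN, hg.symm⟩
    refine ⟨ψ g, hgN.2, ?_⟩
    change q (ψ.symm (ψ g) • p) = f
    rw [ψ.left_inv hgN.1, ← hg]
    change (h.equiv (dom (dom.symm (S f)))).2 = f
    rw [dom.right_inv hf, e3]
  -- The image of `B` contains an open set of `F`, while a `C¹` map does not raise Hausdorff
  -- dimension.
  have hdim : (Module.finrank ℝ F : ENNReal) ≤ Module.finrank ℝ EG := by
    rw [← Real.dimH_of_mem_nhds himage, ← Real.dimH_univ_eq_finrank EG]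
    exact (hQB.dimH_image_le (convex_ball _ _) subset_rfl).trans (dimH_mono (subset_univ _))
  exact_mod_cast hdim

/-- In a submersion chart `π` is a linear projection, so a vertical vector has no base component and
is determined by its component in the complement `F`. -/
lemma finrank_vertical_le [FiniteDimensional ℝ EG] [IsManifold 𝓘(ℝ, EG) ∞ G] (p : P) :
    Module.finrank ℝ (P.vertical p) ≤ Module.finrank ℝ EG := by
  obtain ⟨F, _, _, h⟩ := P.submersion_π.isSubmersionAt p
  have hEM : FiniteDimensional ℝ (EM × F) := h.equiv.toLinearEquiv.finiteDimensional
  have hF : FiniteDimensional ℝ F :=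
    Module.Finite.of_surjective (LinearMap.snd ℝ EM F) LinearMap.snd_surjective
  refine le_trans ?_ (P.finrank_complement_le h)
  set dom := h.domChart.extend 𝓘(ℝ, P.E) with hdom
  set cod := h.codChart.extend 𝓘(ℝ, EM) with hcod
  have hd1 : MDifferentiableAt 𝓘(ℝ, P.E) 𝓘(ℝ, P.E) dom p :=
    (h.domChart.contMDiffAt_extend h.domChart_mem_maximalAtlas
      h.mem_domChart_source).mdifferentiableAt (by simp)
  have hd2 : MDifferentiableAt 𝓘(ℝ, EM) 𝓘(ℝ, EM) cod (P.π p) :=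
    (h.codChart.contMDiffAt_extend h.codChart_mem_maximalAtlas
      h.mem_codChart_source).mdifferentiableAt (by simp)
  have hd3 : MDifferentiableAt 𝓘(ℝ, P.E) 𝓘(ℝ, EM) P.π p :=
    h.contMDiffAt.mdifferentiableAt (by simp)
  have hdt : dom.target ∈ 𝓝 (dom p) := by
    have h1 := h.domChart.extend_target_mem_nhdsWithin (I := 𝓘(ℝ, P.E)) h.mem_domChart_source
    rwa [modelWithCornersSelf_coe, range_id, nhdsWithin_univ] at h1
  have hds : dom.source ∈ 𝓝 p := h.domChart.extend_source_mem_nhds h.mem_domChart_source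
  have hd4 : MDifferentiableAt 𝓘(ℝ, P.E) 𝓘(ℝ, P.E) dom.symm (dom p) := by
    refine ((contMDiffOn_extend_symm h.domChart_mem_maximalAtlas).contMDiffAt
      ?_).mdifferentiableAt (n := ∞) (by simp)
    rwa [← OpenPartialHomeomorph.extend_target']
  let D : P.E →L[ℝ] P.E := mfderiv 𝓘(ℝ, P.E) 𝓘(ℝ, P.E) dom p
  have hDinj : Function.Injective D := by
    have h1 := mfderiv_comp p hd4 hd1
    have h2 : dom.symm ∘ dom =ᶠ[𝓝 p] id := by
      filter_upwards [hds] with y hy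
      exact dom.left_inv hy
    rw [h2.mfderiv_eq, mfderiv_id] at h1
    refine Function.LeftInverse.injective
      (g := (mfderiv 𝓘(ℝ, P.E) 𝓘(ℝ, P.E) dom.symm (dom p) : P.E → P.E)) fun v => ?_
    exact (DFunLike.congr_fun h1 v).symm
  have hfst : ∀ v : P.E, v ∈ P.vertical p → (h.equiv (D v)).1 = 0 := by
    intro v hv
    let L : P.E →L[ℝ] EM := (ContinuousLinearMap.fst ℝ EM F).comp (h.equiv : P.E →L[ℝ] EM × F)
    have h1 : L ∘ dom =ᶠ[𝓝 p] cod ∘ P.π := by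
      filter_upwards [hds] with y hy
      have := h.writtenInCharts (dom.map_source hy)
      have e : cod (P.π (dom.symm (dom y))) = L (dom y) := this
      rw [dom.left_inv hy] at e
      exact e.symm
    have h2 := h1.mfderiv_eq (I := 𝓘(ℝ, P.E)) (I' := 𝓘(ℝ, EM))
    rw [mfderiv_comp p L.differentiableAt.mdifferentiableAt hd1, mfderiv_comp p hd2 hd3,
      mfderiv_eq_fderiv, L.fderiv] at h2
    have h3 := DFunLike.congr_fun h2 v
    refine h3.trans ?_
    exact (congrArg (mfderiv 𝓘(ℝ, EM) 𝓘(ℝ, EM) cod (P.π p)) hv).trans (map_zero _)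
  let T : P.vertical p →ₗ[ℝ] F := (LinearMap.snd ℝ EM F ∘ₗ h.equiv.toLinearEquiv.toLinearMap ∘ₗ
    D.toLinearMap) ∘ₗ (P.vertical p).subtype
  refine LinearMap.finrank_le_finrank_of_injective (f := T) ?_
  rw [injective_iff_map_eq_zero]
  rintro ⟨v, hv⟩ hTv
  have h1 : h.equiv (D v) = 0 := Prod.ext (hfst v hv) hTv
  have h2 : D v = 0 := (map_eq_zero_iff h.equiv h.equiv.injective).1 h1
  exact Subtype.ext (hDinj (h2.trans (map_zero D).symm))

/-- The vertical vectors are the values of the fundamental vector fields. -/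
lemma exists_fundamental_eq_of_mem_vertical [FiniteDimensional ℝ EG] [LieGroup 𝓘(ℝ, EG) ∞ G]
    {p : P} {w : P.T p} (hw : w ∈ P.vertical p) :
    ∃ α : GroupLieAlgebra 𝓘(ℝ, EG) G, P.fundamental α p = w := by
  have : CompleteSpace EG := FiniteDimensional.complete ℝ EG
  have : FiniteDimensional ℝ (P.T p) := inferInstanceAs (FiniteDimensional ℝ P.E)
  let O : EG →ₗ[ℝ] P.T p := (P.dOrbit p 1 : EG →L[ℝ] P.E).toLinearMap
  have hO : Function.Injective O := P.dOrbit_one_injective p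
  have hle : O.range ≤ P.vertical p := by
    rintro _ ⟨α, rfl⟩
    have hd3 : MDifferentiableAt 𝓘(ℝ, P.E) 𝓘(ℝ, EM) P.π ((1 : G) • p) :=
      (P.submersion_π.isSubmersionAt _).contMDiffAt.mdifferentiableAt (by simp)
    have h1 := mfderiv_comp (1 : G) hd3 (((P.contMDiff_orbit p) 1).mdifferentiableAt (by simp))
    have h2 : P.π ∘ (fun g : G => g • p) = fun _ => P.π p := funext fun g => P.invariant_π g p
    rw [h2, mfderiv_const] at h1
    have key : ∀ (q : P) (e : P.E), q = p → (mfderiv 𝓘(ℝ, P.E) 𝓘(ℝ, EM) P.π q e : EM) =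
        mfderiv 𝓘(ℝ, P.E) 𝓘(ℝ, EM) P.π p e := by
      rintro q e rfl; rfl
    exact (key _ _ (one_smul G p)).symm.trans (DFunLike.congr_fun h1 α).symm
  -- The injective image of `𝔤` lies in a space of dimension at most `dim 𝔤`.
  have heq : O.range = P.vertical p := by
    refine Submodule.eq_of_le_of_finrank_le hle ?_
    rw [LinearMap.finrank_range_of_inj hO]
    exact P.finrank_vertical_le p
  rw [← heq] at hw
  exact hw

end PrincipalBundle
end Vertical

/-! ### From Pfaffian bundles to forms, and from forms to foliations. -/

section Equivalence

variable {EG : Type*} [NormedAddCommGroup EG] [NormedSpace ℝ EG]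
  {G : Type*} [Group G] [TopologicalSpace G] [ChartedSpace EG G] [LieGroup 𝓘(ℝ, EG) ∞ G]
  {V : Type*} [NormedAddCommGroup V] [NormedSpace ℝ V]
  {EM : Type*} [NormedAddCommGroup EM] [NormedSpace ℝ EM]
  {M : Type*} [TopologicalSpace M] [ChartedSpace EM M]

/-- A constant map has zero differential. Hence the moment map condition reduces to verticality of
`ker θ`, and the symbol of a Pfaffian group is all of `ker ω`. -/
lemma kerToPoint_eq_top {E : Type*} [NormedAddCommGroup E] [NormedSpace ℝ E]
    {X : Type*} [TopologicalSpace X] [ChartedSpace E X] (x : X) :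
    kerToPoint (E := E) x = ⊤ := by
  rw [kerToPoint, mfderiv_const]
  exact LinearMap.ker_zero

/-- Multiplicativity at `(g, 1)` on the vector `(0, α)`. In particular, left invariant fields of
elements of `𝔥` stay in `ker ω`. -/
lemma PfaffianGroup.form_mulInvariantVectorField (A : PfaffianGroup EG G V) (g : G)
    (α : GroupLieAlgebra 𝓘(ℝ, EG) G) :
    A.form g (mulInvariantVectorField α g) = A.ρ g (A.l α) := by
  have h := mfderiv_prod_eq_add_apply (p := ((g, 1) : G × G)) (v := ((0, α) : EG × EG))
    ((contMDiff_mul 𝓘(ℝ, EG) (G := G) ∞).mdifferentiableAt (by simp))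
  have h0 : (mfderiv 𝓘(ℝ, EG) 𝓘(ℝ, EG) (fun z : G => z * 1) g) (0 : EG) = 0 := map_zero _
  have h1 : (mfderiv (𝓘(ℝ, EG).prod 𝓘(ℝ, EG)) 𝓘(ℝ, EG) (fun x : G × G => x.1 * x.2) (g, 1)
      ((0, α) : EG × EG) : EG) = mulInvariantVectorField α g := by
    refine h.trans ((congrArg (· + _) h0).trans ?_)
    exact zero_add _
  have key : ∀ (k : G) (e e' : EG), k = g → e = e' → A.form k e = A.form g e' := by
    rintro k e e' rfl rfl; rfl
  have h2 := A.multiplicative g 1 (0 : EG) α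
  refine (key _ _ _ (mul_one g) h1).symm.trans (h2.trans ?_)
  have h3 : A.form g (0 : EG) = 0 := map_zero _
  rw [h3, zero_add]
  rfl

/-- The exterior derivative of the form of a Pfaffian group vanishes on `𝔥`. -/
lemma PfaffianGroup.extD_form_eq_zero [FiniteDimensional ℝ EG] (A : PfaffianGroup EG G V)
    {α β : GroupLieAlgebra 𝓘(ℝ, EG) G} (hα : A.l α = 0) (hβ : A.l β = 0) :
    extD A.form 1 α β = 0 := by
  have hker : ∀ α : GroupLieAlgebra 𝓘(ℝ, EG) G, A.l α = 0 → ∀ g ∈ (univ : Set G),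
      A.form g (mulInvariantVectorField α g) = 0 := by
    intro α hα g _
    rw [A.form_mulInvariantVectorField, hα, map_zero]
  have hs := fun α : GroupLieAlgebra 𝓘(ℝ, EG) G =>
    (contMDiff_infty_mulInvariantVectorField α).contMDiffOn (s := univ)
  have h1 := apply_mlieBracket_eq_neg_extD A.smooth_form (x := (1 : G)) univ_mem (hs α) (hs β)
    (hker α hα) (hker β hβ)
  have hmem : ∀ α : GroupLieAlgebra 𝓘(ℝ, EG) G, A.l α = 0 → ∀ g ∈ (univ : Set G),
      mulInvariantVectorField α g ∈ (A.form g).ker ⊓ kerToPoint g := by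
    intro α hα g hg
    rw [kerToPoint_eq_top, inf_top_eq]
    exact hker α hα g hg
  have h2 := (A.symbol_involutive univ isOpen_univ _ _ (hs α) (hs β) (hmem α hα) (hmem β hβ) 1
    (mem_univ _)).1
  have h3 : A.form 1 (VectorField.mlieBracket 𝓘(ℝ, EG) (mulInvariantVectorField α)
    (mulInvariantVectorField β) (1 : G)) = 0 := h2
  rw [h3, mulInvariantVectorField_one, mulInvariantVectorField_one] at h1
  exact neg_eq_zero.1 h1.symm

variable {A : PfaffianGroup EG G V} {P : PrincipalBundle.{u, v} EG G EM M}

namespace FullPfaffian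

variable (S : FullPfaffian A P)

lemma apply_dOrbit (p : P) (g : G) (v : TangentSpace 𝓘(ℝ, EG) g) :
    S.θ (g • p) (P.dOrbit p g v) = A.form g v := by
  have h := S.multiplicative g p v (0 : P.T p)
  rwa [P.mfderiv_smul_apply, map_zero, map_zero, map_zero, add_zero, add_zero] at h

lemma equivariant : IsEquivariantForm A P S.θ := by
  intro g p w
  have h := S.multiplicative g p (0 : TangentSpace 𝓘(ℝ, EG) g) w
  rwa [P.mfderiv_smul_apply, map_zero, map_zero, zero_add, zero_add] at h

lemma apply_fundamental (α : GroupLieAlgebra 𝓘(ℝ, EG) G) (p : P) :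
    S.θ p (P.fundamental α p) = A.l α := by
  have key : ∀ (q : P) (e : P.E), q = p → S.θ q e = S.θ p e := by
    rintro q e rfl; rfl
  exact (key _ _ (one_smul G p)).symm.trans (S.apply_dOrbit p 1 α)

lemma ker_vertical (p : P) : (S.θ p).ker ≤ P.vertical p := by
  have h := S.moment_projection p
  rw [kerToPoint_eq_top, top_inf_eq] at h
  rw [h]
  exact inf_le_left

/-- The kernel of `θ` is spanned by the fundamental vector fields of `𝔥`, and the pullback of `θ` to
an orbit is the form of the Pfaffian group, whose kernel is involutive. -/
lemma ker_involutive [FiniteDimensional ℝ EG] : IsInvolutive fun p : P => (S.θ p).ker := by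
  intro U hU Y Z hY hZ hθY hθZ p hp
  have h1 := apply_mlieBracket_eq_neg_extD S.smooth (hU.mem_nhds hp) hY hZ hθY hθZ
  obtain ⟨α, hα⟩ := P.exists_fundamental_eq_of_mem_vertical (S.ker_vertical p (hθY p hp))
  obtain ⟨β, hβ⟩ := P.exists_fundamental_eq_of_mem_vertical (S.ker_vertical p (hθZ p hp))
  have hlα : A.l α = 0 := by
    rw [← S.apply_fundamental α p, hα]; exact hθY p hp
  have hlβ : A.l β = 0 := by
    rw [← S.apply_fundamental β p, hβ]; exact hθZ p hp
  -- On the orbit through `p`, `θ` pulls back to `A.form`, so its exterior derivative can be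
  -- computed on the group.
  have h2 := extD_pullback S.smooth (P.contMDiff_orbit p)
    (fun g v => (S.apply_dOrbit p g v).symm) 1 α β
  rw [A.extD_form_eq_zero hlα hlβ] at h2
  have key : ∀ (q : P) (e e' : P.E), q = p → extD S.θ q e e' = extD S.θ p e e' := by
    rintro q e e' rfl; rfl
  have h3 : extD S.θ p (P.fundamental α p) (P.fundamental β p) = 0 :=
    (key _ _ _ (one_smul G p)).symm.trans h2.symm
  rw [← hα, ← hβ, h3, neg_zero] at h1
  exact h1

/-- A full principal Pfaffian bundle, as an equivariant form with involutive vertical kernel. -/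
def toFormData [FiniteDimensional ℝ EG] : FormData A P where
  θ := S.θ
  smooth := S.smooth
  surjective := S.full
  equivariant := S.equivariant
  ker_involutive := S.ker_involutive
  ker_vertical := S.ker_vertical
  fundamental := S.apply_fundamental

end FullPfaffian

namespace FormData

variable (S : FormData A P)

/-- An equivariant form with involutive vertical kernel makes a principal bundle into a full
principal Pfaffian bundle. -/
def toFullPfaffian : FullPfaffian A P where
  θ := S.θ
  smooth := S.smooth
  multiplicative g p v w := by
    rw [P.mfderiv_smul_apply, map_add, S.equivariant]
    -- With `v` left invariant, both `θ` of the orbit derivative and `A.form g v` become `A.ρ g (A.l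
    -- α)`.
    obtain ⟨α, rfl⟩ := exists_eq_mulInvariantVectorField g v
    rw [P.dOrbit_mulInvariantVectorField, S.equivariant, S.fundamental,
      A.form_mulInvariantVectorField]
  moment_projection p := by
    rw [kerToPoint_eq_top, top_inf_eq]
    exact (inf_eq_right.2 (S.ker_vertical p)).symm
  full := S.surjective

/-- The foliation and the trivialization of its normal bundle defined by an equivariant form with
involutive vertical kernel. -/
def toFoliationData [FiniteDimensional ℝ V] : FoliationData A P where
  F :=
    { tangent := fun p => (S.θ p).ker
      regular := isRegularDistribution_ker S.smooth S.surjective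
      involutive := S.ker_involutive }
  F_equivariant g p := by
    apply le_antisymm
    · rintro _ ⟨w, hw, rfl⟩
      have hw' : S.θ p w = 0 := hw
      refine (S.equivariant g p w).trans ?_
      rw [hw', map_zero]
    · intro w hw
      have hw' : S.θ (g • p) w = 0 := hw
      -- The preimage is the translate by `g⁻¹`; it lies in the kernel because `A.ρ g` is
      -- invertible.
      refine ⟨(P.dAct g⁻¹ (g • p) w : P.E), ?_, P.dAct_dAct_inv g p w⟩
      have h := S.equivariant g p (P.dAct g⁻¹ (g • p) w : P.E)
      rw [P.dAct_dAct_inv, hw'] at h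
      have h2 := congrArg (A.ρ g⁻¹) h
      rw [map_zero, Representation.inv_self_apply] at h2
      exact h2.symm
  F_vertical := S.ker_vertical
  Φ p := (S.θ p : P.T p →ₗ[ℝ] V).quotKerEquivOfSurjective (S.surjective p)
  Φ_smooth := S.smooth
  Φ_equivariant := S.equivariant
  Φ_fundamental := S.fundamental

end FormData

namespace FoliationData

/-- The form `Φ ∘ [·]` defined by a foliation with a trivialization of its normal bundle. -/
def form (D : FoliationData A P) (p : P) : P.T p →L[ℝ] V :=
  (LinearMap.toContinuousLinearMap
    ((D.Φ p : (P.T p ⧸ D.F.tangent p) →ₗ[ℝ] V) ∘ₗ (D.F.tangent p).mkQ : P.E →ₗ[ℝ] V) :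
    P.E →L[ℝ] V)

lemma ker_form (D : FoliationData A P) (p : P) : (D.form p).ker = D.F.tangent p := by
  ext w
  change D.Φ p ((D.F.tangent p).mkQ w) = 0 ↔ w ∈ D.F.tangent p
  rw [LinearEquiv.map_eq_zero_iff, Submodule.mkQ_apply, Submodule.Quotient.mk_eq_zero]

/-- A foliation with a trivialization of its normal bundle, as an equivariant form with involutive
vertical kernel. -/
def toFormData (D : FoliationData A P) : FormData A P where
  θ := D.form
  smooth := D.Φ_smooth
  surjective p := (D.Φ p).surjective.comp (D.F.tangent p).mkQ_surjective
  equivariant := D.Φ_equivariant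
  ker_involutive := by rw [funext D.ker_form]; exact D.F.involutive
  ker_vertical p := (D.ker_form p).trans_le (D.F_vertical p)
  fundamental := D.Φ_fundamental

/-- The type of `Φ` depends on the foliation, so the distributions are identified first; `Φ` is then
determined by its composite with the quotient map. -/
lemma eq_of_tangent_of_apply {D D' : FoliationData A P} (hF : D.F.tangent = D'.F.tangent)
    (hΦ : ∀ (p : P) (w : P.T p),
      D.Φ p ((D.F.tangent p).mkQ w) = D'.Φ p ((D'.F.tangent p).mkQ w)) : D = D' := by
  obtain ⟨⟨T, _, _⟩, _, _, Φ, _, _, _⟩ := D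
  obtain ⟨⟨T', _, _⟩, _, _, Φ', _, _, _⟩ := D'
  obtain rfl : T = T' := hF
  obtain rfl : Φ = Φ' := by
    funext p
    ext x
    obtain ⟨w, rfl⟩ := (T p).mkQ_surjective x
    exact hΦ p w
  rfl

end FoliationData

/-- Full principal Pfaffian bundles are equivariant forms with involutive vertical kernel. -/
def fullPfaffianEquivFormData [FiniteDimensional ℝ EG] (A : PfaffianGroup EG G V)
    (P : PrincipalBundle.{u, v} EG G EM M) : FullPfaffian A P ≃ FormData A P where
  toFun S := S.toFormData
  invFun S := S.toFullPfaffian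
  left_inv _ := rfl
  right_inv _ := rfl

/-- Equivariant forms with involutive vertical kernel are equivariant vertical foliations with a
trivialization of the normal bundle. -/
def formDataEquivFoliationData [FiniteDimensional ℝ V] (A : PfaffianGroup EG G V)
    (P : PrincipalBundle.{u, v} EG G EM M) : FormData A P ≃ FoliationData A P where
  toFun S := S.toFoliationData
  invFun D := D.toFormData
  left_inv _ := by
    apply FormData.ext
    funext p
    ext w
    rfl
  right_inv D := FoliationData.eq_of_tangent_of_apply (funext D.ker_form)
    fun _ _ => rfl

end Equivalence
end Pfaffian
end

open Pfaffian
theorem mainTheorem7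
    {EG : Type*} [NormedAddCommGroup EG] [NormedSpace ℝ EG] [FiniteDimensional ℝ EG]
    {G : Type*} [Group G] [TopologicalSpace G] [ChartedSpace EG G] [LieGroup 𝓘(ℝ, EG) ∞ G]
    [T2Space G]
    {V : Type*} [NormedAddCommGroup V] [NormedSpace ℝ V] [FiniteDimensional ℝ V]
    {EM : Type*} [NormedAddCommGroup EM] [NormedSpace ℝ EM] [FiniteDimensional ℝ EM]
    {M : Type*} [TopologicalSpace M] [ChartedSpace EM M] [IsManifold 𝓘(ℝ, EM) ∞ M] [T2Space M]
    (A : PfaffianGroup EG G V) :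
    (∃ e : ∀ P : PrincipalBundle EG G EM M, FullPfaffian A P ≃ FoliationData A P,
      (∀ P (S : FullPfaffian A P) (p : P), (e P S).F.tangent p = (S.θ p).ker) ∧
      (∀ P (S : FullPfaffian A P) (p : P) (w : P.T p),
        (e P S).Φ p (((e P S).F.tangent p).mkQ w) = S.θ p w) ∧
      (∀ P Q (S : FullPfaffian A P) (S' : FullPfaffian A Q) (Ψ : PrincipalBundle.Hom P Q),
        S.IsMorphism S' Ψ ↔ (e P S).IsMorphism (e Q S') Ψ)) ∧
    (∃ e : ∀ P : PrincipalBundle EG G EM M, FullPfaffian A P ≃ FormData A P,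
      (∀ P (S : FullPfaffian A P) (p : P), (e P S).θ p = S.θ p) ∧
      (∀ P Q (S : FullPfaffian A P) (S' : FullPfaffian A Q) (Ψ : PrincipalBundle.Hom P Q),
        S.IsMorphism S' Ψ ↔ (e P S).IsMorphism (e Q S') Ψ)) := by
  refine ⟨⟨fun P => (fullPfaffianEquivFormData A P).trans (formDataEquivFoliationData A P),
    fun _ _ _ => rfl, fun _ _ _ _ => rfl, fun P Q S S' Ψ => ⟨fun h => ⟨fun p => ?_, h⟩, And.right⟩⟩,
    ⟨fun P => fullPfaffianEquivFormData A P, fun _ _ _ => rfl, fun _ _ _ _ _ => Iff.rfl⟩⟩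
  -- Only the condition on leaves needs an argument: preservation of the forms sends `ker θ` into
  -- `ker θ'`.
  rintro _ ⟨w, hw, rfl⟩
  exact (h p w).trans hw
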